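/- Let $n\ge 0$ and let $\overrightarrow{G}=([n],E)$ be a simple digraph, i.e. $E$ is a set of ordered pairs of distinct elements of $[n]=\{1,\dots,n\}$ (both $(u,v)$ and $(v,u)$ may belong to $E$). Let $G$ be its underlying undirected simple graph, in which $u\ne v$ are adjacent if and only if $(u,v)\in E$ or $(v,u)\in E$. For an integer $m\ge 0$ put $$\chi_{\overrightarrow{G}}(m,t)=\sum_{\kappa}t^{\mathrm{asc}(\kappa)},$$ where $\kappa$ runs over all proper colorings $\kappa:[n]\to[m]$ of $G$ and $\mathrm{asc}(\kappa)$ is the number of $(u,v)\in E$ with $\kappa(u)<\kappa(v)$. For a permutation $\sigma=\sigma_1\sigma_2\cdots\sigma_n\in\mathfrak S_n$, a $\overrightarrow{G}$-inversion of $\sigma$ is a directed edge $(u,v)\in E$ such that $v$ precedes $u$ in $\sigma$. For $x\in[n]$, the rank $\mathrm{rank}_{(G,\sigma)}(x)$ is the length of the longest (not necessarily contiguous) subword of $\sigma$ that ends in $x$ and in which any two consecutive letters are adjacent in $G$. A $G$-descent of $\sigma$ is an $i$ with $1\le i<n$ such that either $\mathrm{rank}_{(G,\sigma)}(\sigma_i)>\mathrm{rank}_{(G,\sigma)}(\sigma_{i+1})$,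 or $\mathrm{rank}_{(G,\sigma)}(\sigma_i)=\mathrm{rank}_{(G,\sigma)}(\sigma_{i+1})$ and $\sigma_i>\sigma_{i+1}$. For $k,l\ge 0$ let $\delta_{\overrightarrow{G}}(k,l)$ be the number of $\sigma\in\mathfrak S_n$ with exactly $k$ $G$-descents and exactly $l$ $\overrightarrow{G}$-inversions; only finitely many of these numbers are nonzero. Then for every integer $m\ge 0$ $$\chi_{\overrightarrow{G}}(m,t)=\sum_{k,l\ge 0}\delta_{\overrightarrow{G}}(k,l)\binom{m+k}{n}t^l .$$ Consequently $\chi_{\overrightarrow{G}}(m,t)$ is a polynomial in $m$ whose coefficients are palindromic polynomials in $t$: there are $a_0(t),\dots,a_d(t)\in\mathbb Q[t]$ with $\chi_{\overrightarrow{G}}(m,t)=\sum_{j=0}^d a_j(t)m^j$ for all integers $m\ge 0$, and each $a_j(t)=\sum_{i=0}^{|E|}a_{j,i}t^i$ satisfies $a_{j,i}=a_{j,|E|-i}$ for $0\le i\le |E|$. -/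

import Mathlib

open Polynomial

open scoped Classical in
/-- The finite set of directed edges `(u, v)` of a digraph. -/
noncomputable def diEdges {V : Type*} [Fintype V] (D : Digraph V) : Finset (V × V) :=
  Finset.univ.filter fun e => D.Adj e.1 e.2

/-- The number of ascents of a coloring `κ`: directed edges `(u, v)` with `κ u < κ v`. -/
noncomputable def ascCount {V : Type*} [Fintype V] (D : Digraph V) {m : ℕ} (κ : V → Fin m) : ℕ :=
  ((diEdges D).filter fun e => κ e.1 < κ e.2).card

/-- The `t`-analog of the chromatic polynomial of a digraph, evaluated at the number `m` of colors,
as a polynomial in the variable `t`: the sum of `t ^ asc κ` over all proper colorings `κ` of the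
underlying undirected graph with colors in an ordered set of `m` colors. -/
noncomputable def tChromatic {V : Type*} [Fintype V] (D : Digraph V) (m : ℕ) : ℚ[X] :=
  ∑ κ : D.toSimpleGraphInclusive.Coloring (Fin m), X ^ ascCount D κ

/-- The number of inversions of `σ` with respect to a digraph: directed edges `(u, v)` such that
`v` precedes `u` in the word `σ 0, σ 1, …, σ (n - 1)`. -/
noncomputable def diInv {n : ℕ} (D : Digraph (Fin n)) (σ : Equiv.Perm (Fin n)) : ℕ :=
  ((diEdges D).filter fun e => σ.symm e.2 < σ.symm e.1).card

/-- The `(G, σ)`-rank of `x`: the length of the longest subword of `σ 0, σ 1, …, σ (n - 1)` which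
ends in `x` and in which consecutive letters are adjacent in `G`. The set of lengths contains `1`
and is bounded by `n`, so its supremum is its maximum. -/
noncomputable def gRank {n : ℕ} (G : SimpleGraph (Fin n)) (σ : Equiv.Perm (Fin n)) (x : Fin n) :
    ℕ :=
  sSup {k : ℕ | ∃ w : List (Fin n), List.Sublist w (List.ofFn σ) ∧ w.getLast? = some x ∧
    w.IsChain G.Adj ∧ w.length = k}

open scoped Classical in
/-- The set of `G`-descents of `σ`; positions are numbered from `0`, so a `G`-descent at the
position `i` compares the letters `σ i` and `σ (i + 1)`, where `i + 1 < n`. -/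
noncomputable def gDescents {n : ℕ} (G : SimpleGraph (Fin n)) (σ : Equiv.Perm (Fin n)) :
    Finset (Fin n) :=
  Finset.univ.filter fun i => ∃ h : (i : ℕ) + 1 < n,
    gRank G σ (σ ⟨(i : ℕ) + 1, h⟩) < gRank G σ (σ i) ∨
      (gRank G σ (σ i) = gRank G σ (σ ⟨(i : ℕ) + 1, h⟩) ∧ σ ⟨(i : ℕ) + 1, h⟩ < σ i)

/-- The number of permutations with exactly `k` descents with respect to the underlying undirected
graph and exactly `l` inversions with respect to the digraph. -/
noncomputable def diDelta {n : ℕ} (D : Digraph (Fin n)) (k l : ℕ) : ℕ :=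
  (Finset.univ.filter fun σ : Equiv.Perm (Fin n) =>
    (gDescents D.toSimpleGraphInclusive σ).card = k ∧ diInv D σ = l).card

/-- A polynomial `∑_{i ≤ N} aᵢ tⁱ` with `aᵢ = a_{N - i}`, that is, palindromic with center of
symmetry `N / 2`. -/
def IsPalindromicOfCenter (N : ℕ) (p : ℚ[X]) : Prop :=
  p.natDegree ≤ N ∧ ∀ i ≤ N, p.coeff i = p.coeff (N - i)

/-! Each proper coloring `κ` is assigned the unique permutation `σ` that lists the vertices by
decreasing color, ties broken by decreasing rank and then label. The rank refers to `σ` itself, but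
it only depends on which end of each edge comes first, and for a proper coloring the colors decide
that; so `σ` exists (`exists_sortsColoring`) and is unique (`SortsColoring.unique`). Ascents of `κ`
become inversions of `σ`. Conversely, the colorings assigned to a fixed `σ` are the weakly
decreasing words constant only at `G`-descents, and `card_antitone_strict_off` counts them by one
binomial coefficient. Palindromicity comes from reversing the colors: it holds at every `m`, hence
for each coefficient of the polynomial in `m`. -/

/-! ### Counting decreasing sequences with prescribed strict steps -/

theorem Fin.strictAnti_iff_next_lt {n : ℕ} {α : Type*} [Preorder α] {f : Fin n → α} :
    StrictAnti f ↔ ∀ (i : Fin n) (h : (i : ℕ) + 1 < n), f ⟨i + 1, h⟩ < f i := by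
  cases n with
  | zero => exact ⟨fun _ i => i.elim0, fun _ i => i.elim0⟩
  | succ n =>
    rw [Fin.strictAnti_iff_succ_lt]
    exact ⟨fun h i hi => h ⟨i, by omega⟩, fun h i => h i.castSucc (by simp)⟩

/-- A strictly decreasing sequence is determined by its set of values, which is an arbitrary
`n`-subset. -/
theorem card_strictAnti_fin (n M : ℕ) [Fintype {b : Fin n → Fin M // StrictAnti b}] :
    Fintype.card {b : Fin n → Fin M // StrictAnti b} = M.choose n := by
  classical
  let e : {b : Fin n → Fin M // StrictAnti b} ≃ (Fin n ↪o (Fin M)ᵒᵈ) :=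
    { toFun := fun b => OrderEmbedding.ofStrictMono (fun i => OrderDual.toDual (b.1 i))
        fun i j hij => OrderDual.toDual_lt_toDual.2 (b.2 hij)
      invFun := fun f => ⟨fun i => OrderDual.ofDual (f i), fun i j hij =>
        OrderDual.ofDual_lt_ofDual.2 (f.strictMono hij)⟩
      left_inv := fun b => rfl
      right_inv := fun f => by ext; rfl }
  rw [← Nat.card_eq_fintype_card, Nat.card_congr (e.trans Set.powersetCard.ofFinEmbEquiv),
    Set.powersetCard.card]
  simp

/-- The number of elements of `D` which are at least `i`. -/
def Finset.countFrom {n : ℕ} (D : Finset (Fin n)) (i : Fin n) : ℕ :=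
  (D.filter fun j => i ≤ j).card

theorem Finset.countFrom_eq_next {n : ℕ} (D : Finset (Fin n)) (i : Fin n) (h : (i : ℕ) + 1 < n) :
    D.countFrom i = D.countFrom ⟨i + 1, h⟩ + if i ∈ D then 1 else 0 := by
  classical
  unfold Finset.countFrom
  split_ifs with hi
  · rw [← Finset.card_insert_of_notMem (a := i)]
    · congr 1
      ext j
      simp only [Finset.mem_filter, Finset.mem_insert, Fin.le_def, Fin.ext_iff]
      constructor
      · rintro ⟨h1, h2⟩
        by_cases h3 : (j : ℕ) = i
        · exact Or.inl h3
        · exact Or.inr ⟨h1, by omega⟩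
      · rintro (h1 | ⟨h1, h2⟩)
        · exact ⟨by rwa [Fin.ext h1], by omega⟩
        · exact ⟨h1, by omega⟩
    · simp [Fin.le_def]
  · congr 1
    ext j
    simp only [Finset.mem_filter, Fin.le_def]
    refine and_congr_right fun hj => ?_
    have : (j : ℕ) ≠ i := fun h => hi (by rwa [← Fin.ext h])
    omega

theorem Finset.countFrom_le_card {n : ℕ} (D : Finset (Fin n)) (i : Fin n) :
    D.countFrom i ≤ D.card :=
  Finset.card_filter_le _ _

theorem Finset.countFrom_zero {n : ℕ} (D : Finset (Fin n)) (h : 0 < n) :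
    D.countFrom ⟨0, h⟩ = D.card := by
  unfold Finset.countFrom
  rw [Finset.filter_true_of_mem]
  intro j _
  simp [Fin.le_def]

theorem Finset.countFrom_lt {n : ℕ} (D : Finset (Fin n)) (hD : ∀ i ∈ D, (i : ℕ) + 1 < n)
    (i : Fin n) : D.countFrom i < n - i := by
  have h : ((D.filter fun j => i ≤ j).map Fin.valEmbedding) ⊆ Finset.Ico (i : ℕ) (n - 1) := by
    intro k hk
    simp only [Finset.mem_map, Finset.mem_filter, Fin.valEmbedding_apply] at hk
    obtain ⟨j, ⟨hj, hij⟩, rfl⟩ := hk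
    have := hD j hj
    rw [Fin.le_def] at hij
    rw [Finset.mem_Ico]
    omega
  have h2 := Finset.card_le_card h
  rw [Finset.card_map, Nat.card_Ico] at h2
  unfold Finset.countFrom
  omega

theorem StrictAnti.le_fin_val {n M : ℕ} {b : Fin n → Fin M} (hb : StrictAnti b) (i : Fin n) :
    n - 1 - i ≤ (b i : ℕ) := by
  have h : (Finset.Ioi i).map ⟨b, hb.injective⟩ ⊆ Finset.Iio (b i) := by
    intro k hk
    simp only [Finset.mem_map, Finset.mem_Ioi, Function.Embedding.coeFn_mk] at hk
    obtain ⟨j, hj, rfl⟩ := hk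
    exact Finset.mem_Iio.2 (hb hj)
  simpa using Finset.card_le_card h

/-- Weakly decreasing sequences which are constant only at steps in `D`, counted by adding to the
entry at `i` the number of elements of `D` from `i` on. -/
theorem card_antitone_strict_off {n m : ℕ} (D : Finset (Fin n))
    (hD : ∀ i ∈ D, (i : ℕ) + 1 < n) :
    Nat.card {a : Fin n → Fin m // ∀ (i : Fin n) (h : (i : ℕ) + 1 < n),
      a ⟨i + 1, h⟩ < a i ∨ a ⟨i + 1, h⟩ = a i ∧ i ∈ D} = (m + D.card).choose n := by
  classical
  rw [← card_strictAnti_fin, ← Nat.card_eq_fintype_card]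
  -- At each step `b` drops by at least one and `countFrom` by at most one, so the bound at position
  -- 0 propagates. With `hge`, subtracting `countFrom` lands in `Fin m`.
  have hlt : ∀ b : Fin n → Fin (m + D.card), StrictAnti b → ∀ (k : ℕ) (hk : k < n),
      (b ⟨k, hk⟩ : ℕ) < m + D.countFrom ⟨k, hk⟩ := by
    intro b hb k
    induction k with
    | zero =>
      intro hk
      rw [D.countFrom_zero hk]
      exact (b _).2
    | succ k ih =>
      intro hk
      have h1 := ih (by omega)
      have h2 := D.countFrom_eq_next ⟨k, by omega⟩ hk
      have h3 : b ⟨k + 1, hk⟩ < b ⟨k, by omega⟩ := hb (by simp [Fin.lt_def])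
      rw [Fin.lt_def] at h3
      dsimp only at h2
      split_ifs at h2 <;> omega
  have hge : ∀ b : Fin n → Fin (m + D.card), StrictAnti b → ∀ i, D.countFrom i ≤ b i := by
    intro b hb i
    have h1 := hb.le_fin_val i
    have h2 := D.countFrom_lt hD i
    omega
  refine Nat.card_congr
    { toFun := fun a => ⟨fun i => ⟨a.1 i + D.countFrom i, ?_⟩, ?_⟩
      invFun := fun b => ⟨fun i => ⟨b.1 i - D.countFrom i, ?_⟩, ?_⟩
      left_inv := ?_
      right_inv := ?_ }
  · exact add_lt_add_of_lt_of_le (a.1 i).2 (D.countFrom_le_card i)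
  · rw [Fin.strictAnti_iff_next_lt]
    intro i h
    have h1 := a.2 i h
    have h2 := D.countFrom_eq_next i h
    rw [Fin.lt_def, Fin.ext_iff] at h1
    rw [Fin.lt_def]
    dsimp only
    split_ifs at h2 with h3
    · omega
    · simp only [h3, and_false, or_false] at h1
      omega
  · have h1 := hlt b.1 b.2 i i.2
    have h2 := hge b.1 b.2 i
    simp only [Fin.eta] at h1
    omega
  · intro i h
    have h1 := Fin.strictAnti_iff_next_lt.1 b.2 i h
    have h2 := D.countFrom_eq_next i h
    have h3 := hge b.1 b.2 i
    have h4 := hge b.1 b.2 ⟨i + 1, h⟩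
    rw [Fin.lt_def] at h1
    simp only [Fin.lt_def, Fin.ext_iff]
    split_ifs at h2 with h5
    · simp only [h5, and_true]
      omega
    · left
      omega
  · intro a
    ext i
    simp
  · intro b
    ext i
    have h3 := hge b.1 b.2 i
    simp only
    omega

/-! ### Subwords of a permutation and the rank -/

theorem List.sublist_ofFn_perm_iff {n : ℕ} (σ : Equiv.Perm (Fin n)) (w : List (Fin n)) :
    w.Sublist (List.ofFn σ) ↔ w.Pairwise fun u v => σ.symm u < σ.symm v := by
  have hσ : (List.ofFn σ).Pairwise fun u v => σ.symm u < σ.symm v := by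
    rw [List.pairwise_ofFn]
    intro i j hij
    simpa using hij
  constructor
  · exact fun h => hσ.sublist h
  · intro hw
    let r : Fin n → Fin n → Prop := fun u v => σ.symm u ≤ σ.symm v
    have : Std.Antisymm r := ⟨fun u v h1 h2 => σ.symm.injective (le_antisymm h1 h2)⟩
    refine List.sublist_of_subperm_of_pairwise (r := r) ?_ (hw.imp fun h => h.le)
      (hσ.imp fun h => h.le)
    refine List.Nodup.subperm (hw.imp fun h => ?_) fun x _ => ?_
    · rintro rfl
      exact lt_irrefl _ h
    · exact (List.mem_ofFn' _ _).2 ⟨σ.symm x, by simp⟩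

theorem List.sublist_ofFn_isChain_iff {n : ℕ} (G : SimpleGraph (Fin n)) (σ : Equiv.Perm (Fin n))
    (w : List (Fin n)) :
    w.Sublist (List.ofFn σ) ∧ w.IsChain G.Adj ↔
      w.IsChain fun u v => G.Adj u v ∧ σ.symm u < σ.symm v := by
  have : Trans (fun u v => σ.symm u < σ.symm v) (fun u v => σ.symm u < σ.symm v)
    (fun u v => σ.symm u < σ.symm v) := ⟨fun h1 h2 => lt_trans h1 h2⟩
  rw [List.sublist_ofFn_perm_iff, ← List.isChain_iff_pairwise]
  constructor
  · rintro ⟨h1, h2⟩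
    rw [List.isChain_iff_getElem] at *
    exact fun i hi => ⟨h2 i hi, h1 i hi⟩
  · exact fun h => ⟨h.imp fun _ _ h => h.2, h.imp fun _ _ h => h.1⟩

/-- The rank depends only on the acyclic orientation of the graph induced by the permutation. -/
theorem gRank_congr {n : ℕ} {G : SimpleGraph (Fin n)} {σ τ : Equiv.Perm (Fin n)}
    (h : ∀ u v, G.Adj u v → (σ.symm u < σ.symm v ↔ τ.symm u < τ.symm v)) :
    gRank G σ = gRank G τ := by
  have h1 : (fun u v => G.Adj u v ∧ σ.symm u < σ.symm v) =
      fun u v => G.Adj u v ∧ τ.symm u < τ.symm v := by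
    ext u v
    exact and_congr_right (h u v)
  funext x
  unfold gRank
  congr 1
  ext k
  refine exists_congr fun w => ?_
  have h2 := List.sublist_ofFn_isChain_iff G σ w
  rw [h1, ← List.sublist_ofFn_isChain_iff G τ w] at h2
  tauto

/-- A longest subword ending in `u` can be extended by `v`. Hence adjacent vertices never tie in
rank. -/
theorem gRank_lt_gRank {n : ℕ} {G : SimpleGraph (Fin n)} {σ : Equiv.Perm (Fin n)} {u v : Fin n}
    (huv : G.Adj u v) (h : σ.symm u < σ.symm v) : gRank G σ u < gRank G σ v := by
  have hb : ∀ x, BddAbove {k : ℕ | ∃ w : List (Fin n), List.Sublist w (List.ofFn σ) ∧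
      w.getLast? = some x ∧ w.IsChain G.Adj ∧ w.length = k} := by
    refine fun x => ⟨n, ?_⟩
    rintro k ⟨w, hw, -, -, rfl⟩
    simpa using hw.length_le
  have hne : {k : ℕ | ∃ w : List (Fin n), List.Sublist w (List.ofFn σ) ∧
      w.getLast? = some u ∧ w.IsChain G.Adj ∧ w.length = k}.Nonempty := by
    refine ⟨1, [u], ?_, rfl, List.isChain_singleton _, rfl⟩
    rw [List.sublist_ofFn_perm_iff]
    exact List.pairwise_singleton _ _
  obtain ⟨w, hw, hlast, hchain, hlen⟩ := Nat.sSup_mem hne (hb u)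
  refine Nat.lt_of_succ_le (le_csSup (hb v) ⟨w ++ [v], ?_⟩)
  have h1 := (List.sublist_ofFn_isChain_iff G σ w).1 ⟨hw, hchain⟩
  have h2 : (w ++ [v]).IsChain fun u v => G.Adj u v ∧ σ.symm u < σ.symm v := by
    rw [List.isChain_append]
    refine ⟨h1, List.isChain_singleton _, ?_⟩
    intro x hx y hy
    rw [hlast] at hx
    simp only [Option.mem_def, Option.some.injEq, List.head?_cons] at hx hy
    subst hx hy
    exact ⟨huv, h⟩
  obtain ⟨h3, h4⟩ := (List.sublist_ofFn_isChain_iff G σ _).2 h2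
  refine ⟨h3, by simp, h4, ?_⟩
  simp [hlen, gRank]

/-! ### The permutation sorting a coloring -/

/-- The word of `σ` lists the vertices with decreasing colors, and vertices of the same color by
decreasing rank and decreasing label. -/
def SortsColoring {n m : ℕ} (G : SimpleGraph (Fin n)) (κ : Fin n → Fin m)
    (σ : Equiv.Perm (Fin n)) : Prop :=
  StrictAnti fun i => toLex (κ (σ i), toLex (gRank G σ (σ i), σ i))

namespace SortsColoring

variable {n m : ℕ} {G : SimpleGraph (Fin n)} {κ : Fin n → Fin m} {σ τ : Equiv.Perm (Fin n)}

/-- With equal colors the later vertex could not have the larger rank, yet rank increases along the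
edge. -/
theorem lt_of_adj (h : SortsColoring G κ σ) {u v : Fin n} (huv : G.Adj u v)
    (hlt : σ.symm u < σ.symm v) : κ v < κ u := by
  have h1 := h hlt
  have h2 := gRank_lt_gRank huv hlt
  simp only [Equiv.apply_symm_apply, Prod.Lex.toLex_lt_toLex] at h1
  rcases h1 with h1 | ⟨-, h1 | ⟨h1, -⟩⟩
  · exact h1
  · omega
  · omega

theorem lt_iff_of_adj (h : SortsColoring G κ σ) {u v : Fin n} (huv : G.Adj u v) :
    σ.symm u < σ.symm v ↔ κ v < κ u := by
  refine ⟨h.lt_of_adj huv, fun h1 => ?_⟩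
  by_contra h2
  rcases (not_lt.1 h2).lt_or_eq with h3 | h3
  · exact lt_asymm h1 (h.lt_of_adj huv.symm h3)
  · exact huv.ne (σ.symm.injective h3).symm

theorem ne_of_adj (h : SortsColoring G κ σ) {u v : Fin n} (huv : G.Adj u v) : κ u ≠ κ v := by
  rcases lt_trichotomy (σ.symm u) (σ.symm v) with h1 | h1 | h1
  · exact (h.lt_of_adj huv h1).ne'
  · exact absurd (σ.symm.injective h1) huv.ne
  · exact (h.lt_of_adj huv.symm h1).ne

theorem unique (hσ : SortsColoring G κ σ) (hτ : SortsColoring G κ τ) : σ = τ := by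
  have hr : gRank G σ = gRank G τ := gRank_congr fun u v huv => by
    rw [hσ.lt_iff_of_adj huv, hτ.lt_iff_of_adj huv]
  unfold SortsColoring at hσ hτ
  rw [hr] at hσ
  let f : Fin n → Fin m ×ₗ ℕ ×ₗ Fin n := fun x => toLex (κ x, toLex (gRank G τ x, x))
  -- Both sides are strictly decreasing enumerations of the range of `f`.
  have h1 : f ∘ σ = f ∘ τ := by
    refine (StrictAnti.range_inj (f := f ∘ σ) (g := f ∘ τ) hσ hτ).1 ?_
    rw [σ.surjective.range_comp, τ.surjective.range_comp]
  ext i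
  have h2 := congrFun h1 i
  simp only [f, Function.comp, EmbeddingLike.apply_eq_iff_eq, Prod.mk.injEq] at h2
  rw [h2.2.2]

end SortsColoring

theorem exists_perm_strictAnti {n : ℕ} {α : Type*} [LinearOrder α] {f : Fin n → α}
    (hf : Function.Injective f) : ∃ σ : Equiv.Perm (Fin n), StrictAnti (f ∘ σ) := by
  refine ⟨Tuple.sort (OrderDual.toDual ∘ f), ?_⟩
  have h1 := Tuple.monotone_sort (OrderDual.toDual ∘ f)
  have h2 : StrictMono ((OrderDual.toDual ∘ f) ∘ Tuple.sort (OrderDual.toDual ∘ f)) :=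
    h1.strictMono_of_injective ((OrderDual.toDual.injective.comp hf).comp (Equiv.injective _))
  exact fun i j hij => OrderDual.toDual_lt_toDual.1 (h2 hij)

theorem exists_sortsColoring {n m : ℕ} {G : SimpleGraph (Fin n)} {κ : Fin n → Fin m}
    (hκ : ∀ u v, G.Adj u v → κ u ≠ κ v) : ∃ σ, SortsColoring G κ σ := by
  have key : ∀ r : Fin n → ℕ, ∃ σ : Equiv.Perm (Fin n),
      StrictAnti fun i => toLex (κ (σ i), toLex (r (σ i), σ i)) := fun r =>
    exists_perm_strictAnti (f := fun x => toLex (κ x, toLex (r x, x))) fun x y h => by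
      simp only [EmbeddingLike.apply_eq_iff_eq, Prod.mk.injEq] at h
      exact h.2.2
  have orient : ∀ (r : Fin n → ℕ) (σ : Equiv.Perm (Fin n)),
      (StrictAnti fun i => toLex (κ (σ i), toLex (r (σ i), σ i))) →
      ∀ u v, G.Adj u v → (σ.symm u < σ.symm v ↔ κ v < κ u) := by
    intro r σ h u v huv
    have h1 := h.lt_iff_gt (a := σ.symm v) (b := σ.symm u)
    simp only [Equiv.apply_symm_apply, Prod.Lex.toLex_lt_toLex, (hκ u v huv).symm, false_and,
      or_false] at h1
    exact h1.symm
  -- This breaks the circularity: any tie-breaking induces the same order on edges, so the rank for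
  -- the provisional `τ` is already the rank for `σ`.
  obtain ⟨τ, hτ⟩ := key fun _ => 0
  obtain ⟨σ, hσ⟩ := key (gRank G τ)
  refine ⟨σ, ?_⟩
  have hr : gRank G σ = gRank G τ := gRank_congr fun u v huv => by
    rw [orient _ _ hσ u v huv, orient (fun _ => 0) τ hτ u v huv]
  unfold SortsColoring
  rwa [hr]

theorem mem_gDescents {n : ℕ} {G : SimpleGraph (Fin n)} {σ : Equiv.Perm (Fin n)} {i : Fin n}
    (h : (i : ℕ) + 1 < n) : i ∈ gDescents G σ ↔
      toLex (gRank G σ (σ ⟨i + 1, h⟩), σ ⟨i + 1, h⟩) < toLex (gRank G σ (σ i), σ i) := by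
  unfold gDescents
  simp only [Finset.mem_filter, Finset.mem_univ, true_and, h, exists_true_left,
    Prod.Lex.toLex_lt_toLex, eq_comm]

theorem add_one_lt_of_mem_gDescents {n : ℕ} {G : SimpleGraph (Fin n)} {σ : Equiv.Perm (Fin n)}
    {i : Fin n} (hi : i ∈ gDescents G σ) : (i : ℕ) + 1 < n := by
  unfold gDescents at hi
  exact (Finset.mem_filter.1 hi).2.1

theorem sortsColoring_iff {n m : ℕ} {G : SimpleGraph (Fin n)} {κ : Fin n → Fin m}
    {σ : Equiv.Perm (Fin n)} : SortsColoring G κ σ ↔ ∀ (i : Fin n) (h : (i : ℕ) + 1 < n),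
      κ (σ ⟨i + 1, h⟩) < κ (σ i) ∨ κ (σ ⟨i + 1, h⟩) = κ (σ i) ∧ i ∈ gDescents G σ := by
  unfold SortsColoring
  rw [Fin.strictAnti_iff_next_lt]
  refine forall₂_congr fun i h => ?_
  rw [mem_gDescents h, Prod.Lex.toLex_lt_toLex]

theorem card_sortsColoring {n : ℕ} (m : ℕ) (G : SimpleGraph (Fin n)) (σ : Equiv.Perm (Fin n)) :
    Nat.card {κ : Fin n → Fin m // SortsColoring G κ σ} =
      (m + (gDescents G σ).card).choose n := by
  rw [← card_antitone_strict_off _ fun i hi => add_one_lt_of_mem_gDescents hi]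
  refine Nat.card_congr ((Equiv.arrowCongr σ.symm (Equiv.refl _)).subtypeEquiv fun κ => ?_)
  rw [sortsColoring_iff]
  rfl

/-! ### Ascents, inversions and the binomial expansion -/

theorem adj_toSimpleGraphInclusive {V : Type*} {D : Digraph V} (hD : ∀ v, ¬ D.Adj v v) {u v : V}
    (h : D.Adj u v) : D.toSimpleGraphInclusive.Adj u v :=
  ⟨fun huv => hD u (by rwa [← huv] at h), Or.inl h⟩

theorem mem_diEdges {V : Type*} [Fintype V] {D : Digraph V} {e : V × V} :
    e ∈ diEdges D ↔ D.Adj e.1 e.2 := by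
  simp [diEdges]

theorem SortsColoring.ascCount_eq {n m : ℕ} {D : Digraph (Fin n)} (hD : ∀ v, ¬ D.Adj v v)
    {κ : Fin n → Fin m} {σ : Equiv.Perm (Fin n)}
    (h : SortsColoring D.toSimpleGraphInclusive κ σ) : ascCount D κ = diInv D σ := by
  unfold ascCount diInv
  congr 1
  refine Finset.filter_congr fun e he => ?_
  exact (h.lt_iff_of_adj (adj_toSimpleGraphInclusive hD (mem_diEdges.1 he)).symm).symm

open scoped Classical in
theorem tChromatic_eq_sum_filter {V : Type*} [Fintype V] [DecidableEq V] (D : Digraph V) (m : ℕ) :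
    tChromatic D m = ∑ κ : V → Fin m with ∀ u v, D.toSimpleGraphInclusive.Adj u v → κ u ≠ κ v,
      X ^ ascCount D κ := by
  unfold tChromatic
  refine Finset.sum_bij (fun κ _ => ⇑κ) ?_ ?_ ?_ ?_
  · exact fun κ _ => Finset.mem_filter.2 ⟨Finset.mem_univ _, fun u v h => κ.valid h⟩
  · exact fun κ _ κ' _ h => DFunLike.coe_injective h
  · exact fun κ hκ => ⟨SimpleGraph.Coloring.mk κ fun h => (Finset.mem_filter.1 hκ).2 _ _ h,
      Finset.mem_univ _, rfl⟩
  · exact fun _ _ => rfl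

theorem tChromatic_eq_sum_perm {n : ℕ} {D : Digraph (Fin n)} (hD : ∀ v, ¬ D.Adj v v) (m : ℕ) :
    tChromatic D m = ∑ σ : Equiv.Perm (Fin n),
      C (((m + (gDescents D.toSimpleGraphInclusive σ).card).choose n : ℕ) : ℚ) *
        X ^ diInv D σ := by
  classical
  let G := D.toSimpleGraphInclusive
  have h1 : ∀ σ : Equiv.Perm (Fin n),
      C (((m + (gDescents G σ).card).choose n : ℕ) : ℚ) * X ^ diInv D σ =
        ∑ κ : Fin n → Fin m with SortsColoring G κ σ, (X : ℚ[X]) ^ ascCount D κ := by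
    intro σ
    rw [Finset.sum_congr rfl fun κ hκ => by
      rw [SortsColoring.ascCount_eq hD (Finset.mem_filter.1 hκ).2]]
    rw [Finset.sum_const, ← card_sortsColoring, Nat.card_eq_fintype_card, Fintype.card_subtype,
      nsmul_eq_mul, map_natCast]
  rw [tChromatic_eq_sum_filter]
  refine Eq.trans ?_ (Finset.sum_congr rfl fun σ _ => (h1 σ).symm)
  simp only [Finset.sum_filter]
  -- After the exchange, the inner sum over `σ` has exactly one term if `κ` is proper and none
  -- otherwise.
  rw [Finset.sum_comm]
  refine Finset.sum_congr rfl fun κ _ => ?_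
  rw [← Finset.sum_filter]
  split_ifs with hκ
  · obtain ⟨σ, hσ⟩ := exists_sortsColoring hκ
    have h2 : (Finset.univ.filter fun τ => SortsColoring G κ τ) = {σ} := by
      ext τ
      simp only [Finset.mem_filter, Finset.mem_univ, true_and, Finset.mem_singleton]
      exact ⟨fun h => h.unique hσ, fun h => h ▸ hσ⟩
    rw [h2, Finset.sum_singleton]
  · rw [Finset.sum_eq_zero]
    intro σ hσ
    exact absurd (fun u v huv => (Finset.mem_filter.1 hσ).2.ne_of_adj huv) hκ

/-- The pair of the numbers of descents and of inversions of a permutation. -/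
noncomputable def desInv {n : ℕ} (D : Digraph (Fin n)) (σ : Equiv.Perm (Fin n)) : ℕ × ℕ :=
  ((gDescents D.toSimpleGraphInclusive σ).card, diInv D σ)

theorem diDelta_eq_card {n : ℕ} (D : Digraph (Fin n)) (p : ℕ × ℕ) :
    diDelta D p.1 p.2 = (Finset.univ.filter fun σ => desInv D σ = p).card := by
  classical
  unfold diDelta desInv
  congr 1
  ext σ
  simp [Prod.ext_iff]

theorem mem_image_of_diDelta_ne_zero {n : ℕ} {D : Digraph (Fin n)} {p : ℕ × ℕ}
    (h : diDelta D p.1 p.2 ≠ 0) : p ∈ Finset.univ.image (desInv D) := by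
  rw [diDelta_eq_card, Finset.card_ne_zero] at h
  obtain ⟨σ, hσ⟩ := h
  exact Finset.mem_image.2 ⟨σ, Finset.mem_univ _, (Finset.mem_filter.1 hσ).2⟩

theorem sum_perm_eq_finsum {n : ℕ} (D : Digraph (Fin n)) (f : ℕ → ℚ) :
    ∑ σ : Equiv.Perm (Fin n), C (f (gDescents D.toSimpleGraphInclusive σ).card) * X ^ diInv D σ =
      ∑ᶠ p : ℕ × ℕ, C ((diDelta D p.1 p.2 : ℚ) * f p.1) * X ^ p.2 := by
  classical
  rw [finsum_eq_sum_of_support_subset (s := Finset.univ.image (desInv D))]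
  · rw [← Finset.sum_fiberwise_of_maps_to (g := desInv D) (t := Finset.univ.image (desInv D))
      fun σ _ => Finset.mem_image_of_mem _ (Finset.mem_univ _)]
    refine Finset.sum_congr rfl fun p _ => ?_
    rw [Finset.sum_congr rfl (g := fun _ => C (f p.1) * X ^ p.2) fun σ hσ => by
      rw [← (Finset.mem_filter.1 hσ).2]; rfl]
    rw [Finset.sum_const, diDelta_eq_card, nsmul_eq_mul, C_mul, map_natCast, mul_assoc]
  · intro p hp
    refine mem_image_of_diDelta_ne_zero fun h => hp ?_
    simp [h]

/-! ### Polynomiality in the number of colors and palindromicity -/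

theorem exists_polynomial_eval_eq_choose (n k : ℕ) :
    ∃ q : ℚ[X], ∀ m : ℕ, q.eval (m : ℚ) = ((m + k).choose n : ℕ) := by
  refine ⟨C ((n.factorial : ℚ)⁻¹) * (descPochhammer ℚ n).comp (X + C (k : ℚ)), fun m => ?_⟩
  have h : (n.factorial : ℚ) ≠ 0 := Nat.cast_ne_zero.2 n.factorial_ne_zero
  rw [eval_mul, eval_C, eval_comp, eval_add, eval_X, eval_C, ← Nat.cast_add,
    descPochhammer_eval_eq_descFactorial, Nat.descFactorial_eq_factorial_mul_choose,
    Nat.cast_mul, inv_mul_cancel_left₀ h]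

/-- Reversing the colors exchanges ascents and descents along edges, and no edge is a tie. -/
theorem ascCount_rev {V : Type*} [Fintype V] {D : Digraph V} {m : ℕ} {κ : V → Fin m}
    (hκ : ∀ u v, D.Adj u v → κ u ≠ κ v) :
    ascCount D (Fin.rev ∘ κ) + ascCount D κ = (diEdges D).card := by
  classical
  unfold ascCount
  rw [add_comm, ← Finset.card_filter_add_card_filter_not (s := diEdges D)
    (fun e => κ e.1 < κ e.2)]
  congr 2
  refine Finset.filter_congr fun e he => ?_
  have h := hκ _ _ (mem_diEdges.1 he)
  simp only [Function.comp, Fin.rev_lt_rev, not_lt]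
  exact ⟨le_of_lt, fun h1 => lt_of_le_of_ne h1 h.symm⟩

theorem isPalindromicOfCenter_iff {N : ℕ} {p : ℚ[X]} :
    IsPalindromicOfCenter N p ↔
      (∀ i, N < i → p.coeff i = 0) ∧ ∀ i ≤ N, p.coeff i = p.coeff (N - i) := by
  unfold IsPalindromicOfCenter
  rw [natDegree_le_iff_coeff_eq_zero]

theorem isPalindromicOfCenter_tChromatic {V : Type*} [Fintype V] {D : Digraph V}
    (hD : ∀ v, ¬ D.Adj v v) (m : ℕ) : IsPalindromicOfCenter (diEdges D).card (tChromatic D m) := by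
  classical
  rw [isPalindromicOfCenter_iff]
  simp only [tChromatic_eq_sum_filter, finsetSum_coeff, coeff_X_pow]
  refine ⟨fun i hi => Finset.sum_eq_zero fun κ _ => if_neg ?_, fun i hi => ?_⟩
  · have : ascCount D κ ≤ (diEdges D).card := Finset.card_filter_le _ _
    omega
  · refine Finset.sum_bij' (fun κ _ => Fin.rev ∘ κ) (fun κ _ => Fin.rev ∘ κ) ?_ ?_ ?_ ?_ ?_
    · intro κ hκ
      simpa [Fin.rev_inj] using hκ
    · intro κ hκ
      simpa [Fin.rev_inj] using hκ
    · intro κ _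
      ext
      simp
    · intro κ _
      ext
      simp
    · intro κ hκ
      have h := ascCount_rev (D := D) (κ := κ) fun u v huv =>
        (Finset.mem_filter.1 hκ).2 u v (adj_toSimpleGraphInclusive hD huv)
      refine if_congr ?_ rfl rfl
      omega

/-- The conditions are linear in the coefficients of powers of `t`, which are themselves polynomials
in `m`; identities at all natural `m` are therefore polynomial identities. -/
theorem isPalindromicOfCenter_coeff_of_eval {N : ℕ} {P : ℚ[X][X]}
    (h : ∀ m : ℕ, IsPalindromicOfCenter N (P.eval (m : ℚ[X]))) (j : ℕ) :
    IsPalindromicOfCenter N (P.coeff j) := by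
  -- `Q i` is the coefficient of `t ^ i` in `P`, as a polynomial in `m`.
  let Q : ℕ → ℚ[X] := fun i => ∑ j ∈ Finset.range (P.natDegree + 1), C ((P.coeff j).coeff i) * X ^ j
  have hQ : ∀ i (m : ℕ), (Q i).eval (m : ℚ) = (P.eval (m : ℚ[X])).coeff i := by
    intro i m
    rw [eval_eq_sum_range (p := P), finsetSum_coeff, eval_finsetSum]
    refine Finset.sum_congr rfl fun j _ => ?_
    rw [← Nat.cast_pow, mul_comm, ← C_eq_natCast, coeff_mul_C, eval_mul, eval_C, eval_pow, eval_X,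
      Nat.cast_pow, mul_comm]
  have hc : ∀ i, (Q i).coeff j = (P.coeff j).coeff i := by
    intro i
    simp only [Q, finsetSum_coeff, coeff_C_mul_X_pow]
    rw [Finset.sum_ite_eq]
    split_ifs with hj
    · rfl
    · rw [coeff_eq_zero_of_natDegree_lt (p := P) (by simpa using hj), coeff_zero]
  have heq : ∀ p q : ℚ[X], (∀ m : ℕ, p.eval (m : ℚ) = q.eval (m : ℚ)) → p = q := fun p q hpq =>
    eq_of_infinite_eval_eq p q
      ((Set.infinite_range_of_injective Nat.cast_injective).mono (Set.range_subset_iff.2 hpq))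
  simp only [isPalindromicOfCenter_iff] at h ⊢
  refine ⟨fun i hi => ?_, fun i hi => ?_⟩
  · rw [← hc, heq (Q i) 0 fun m => by rw [hQ, (h m).1 i hi, eval_zero], coeff_zero]
  · rw [← hc, ← hc, heq (Q i) (Q (N - i)) fun m => by rw [hQ, hQ, (h m).2 i hi]]

theorem corollary3p3 (n : ℕ) (D : Digraph (Fin n)) (hD : ∀ v : Fin n, ¬ D.Adj v v) :
    {p : ℕ × ℕ | diDelta D p.1 p.2 ≠ 0}.Finite ∧
    (∀ m : ℕ, tChromatic D m =
      ∑ᶠ p : ℕ × ℕ, C ((diDelta D p.1 p.2 : ℚ) * ((m + p.1).choose n : ℚ)) * X ^ p.2) ∧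
    (∃ P : ℚ[X][X],
      (∀ m : ℕ, tChromatic D m = P.eval (m : ℚ[X])) ∧
      ∀ j : ℕ, IsPalindromicOfCenter (diEdges D).card (P.coeff j)) := by
  refine ⟨(Finset.univ.image (desInv D)).finite_toSet.subset
    fun p hp => mem_image_of_diDelta_ne_zero hp, fun m => ?_, ?_⟩
  · rw [tChromatic_eq_sum_perm hD]
    exact sum_perm_eq_finsum D fun k => ((m + k).choose n : ℚ)
  · choose q hq using exists_polynomial_eval_eq_choose n
    let P : ℚ[X][X] := ∑ σ : Equiv.Perm (Fin n),
      (q (gDescents D.toSimpleGraphInclusive σ).card).map C * C (X ^ diInv D σ)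
    have hP : ∀ m : ℕ, tChromatic D m = P.eval (m : ℚ[X]) := by
      intro m
      rw [tChromatic_eq_sum_perm hD, eval_finsetSum]
      refine Finset.sum_congr rfl fun σ _ => ?_
      rw [eval_mul, eval_C, eval_natCast_map, hq]
    refine ⟨P, hP, isPalindromicOfCenter_coeff_of_eval fun m => ?_⟩
    rw [← hP]
    exact isPalindromicOfCenter_tChromatic hD m
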